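/- **Setting.** Let $F$ be a finite extension of $\mathbb{Q}_p$ with $p\neq 2$, with ring of integers $O_F$, maximal ideal $\mathfrak p_F=\varpi O_F$ and residue field $\mathbb F=O_F/\mathfrak p_F$ of $q$ elements. Let $\psi:F\to\mathbb C^1$ be a continuous unitary additive character with $\{x\in F\mid \psi(xO_F)=1\}=O_F$. Let $K/F$ be a field extension of degree $n>1$ with $p\nmid n$, with ring of integers $O_K$, maximal ideal $\mathfrak p_K$, ramification index $e$ and inertia degree $f$; let $U_{K/F}=\{\varepsilon\in O_K^\times\mid N_{K/F}(\varepsilon)=1\}$. Let $\beta\in O_K$ satisfy $O_K=O_F[\beta]$ and $T_{K/F}(\beta)=0$, and embed $O_K$ in $M_n(O_F)$ by the regular representation with respect to an $O_F$-basis of $O_K$. Put $G=SL_n$, and for an $O_F$-algebra $R$ let $\mathfrak g(R)$ be the trace-zero matrices in $M_n(R)$, $G_\beta(R)$ and $\mathfrak g_\beta(R)$ the centralizers of $\beta$ in $G(R)$ and $\mathfrak g(R)$. Let $r>1$, $l=\lceil r/2\rceil$, $l'=\lfloor r/2\rfloor$, let $K_m=\ker\bigl(G(O_F/\mathfrak p_F^r)\to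 G(O_F/\mathfrak p_F^m)\bigr)$ and $G(\beta)=\{g\in G(O_F/\mathfrak p_F^r)\mid g\beta g^{-1}\equiv\beta \bmod \mathfrak p_F^{l'}\}=G_\beta(O_F/\mathfrak p_F^r)\cdot K_{l'}$. Let $\theta$ be a continuous unitary character of $U_{K/F}$ which is trivial on $U_{K/F}\cap(1+\mathfrak p_K^{er})$ and satisfies $\theta(\varepsilon)=\psi(\varpi^{-l'}T_{K/F}(x\beta))$ whenever $\varepsilon\in U_{K/F}$, $\varepsilon\equiv 1+\varpi^l x \bmod \mathfrak p_K^{er}$ with $x\in O_K$ and $T_{K/F}(x)\in\mathfrak p_F^{l'}$; regard $\theta$ as a character of $G_\beta(O_F/\mathfrak p_F^r)$ through the canonical surjection $U_{K/F}=G_\beta(O_F)\to G_\beta(O_F/\mathfrak p_F^r)$. **The representation.** $\delta_{\beta,\theta}=\mathrm{Ind}_{G(\beta)}^{G(O_F/\mathfrak p_F^r)}\sigma_{\beta,\theta}$, where $\sigma_{\beta,\theta}$ is as follows. If $r=2l$, then $\sigma_{\beta,\theta}$ is the character $\sigma_{\beta,\theta}(hg)=\theta(h)\chi_\beta(g)$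 for $h\in G_\beta(O_F/\mathfrak p_F^r)$, $g\in K_l$, where $\chi_\beta(1+\varpi^lX)=\psi(\varpi^{-l'}\mathrm{tr}(X\beta))$. If $r=2l-1$, let $\mathbb V_\beta=\mathfrak g(\mathbb F)/\mathfrak g_\beta(\mathbb F)$ with the symplectic form $D_\beta(\dot X,\dot Y)=\mathrm{tr}([X,Y]\overline\beta)$, fix a polarization $\mathbb V_\beta=\mathbb W'\oplus\mathbb W$ and a complement $V$ of $\mathfrak g_\beta(\mathbb F)$ in $\mathfrak g(\mathbb F)$, and put $\widehat\psi(\overline x)=\psi(\varpi^{-1}x)$ for $x\in O_F$. For $v=v_-+v_+\in\mathbb W'\oplus\mathbb W$ let $\sigma^\beta(v)$ be the operator $(\sigma^\beta(v)\phi)(w)=\widehat\psi\bigl(2^{-1}D_\beta(v_-,v_+)+D_\beta(w,v_+)\bigr)\phi(w+v_-)$ on the space $L^2(\mathbb W')$ of complex functions on $\mathbb W'$. Put $\rho_\theta(X \bmod \mathfrak p_F)=\psi(-\varpi^{-l}\mathrm{tr}(X\beta))\,\theta(1+\varpi^{l-1}X+2^{-1}\varpi^{2l-2}X^2 \bmod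 \mathfrak p_F^r)$ for $X\in\mathfrak g_\beta(O_F)$, and for $g=1+\varpi^{l-1}T\bmod\mathfrak p_F^r$ in $K_{l-1}$, with $T\in M_n(O_F)$, put $$\sigma^{\beta,\theta}(g)=\psi\bigl(\varpi^{-l}\mathrm{tr}(T\beta)-2^{-1}\varpi^{-1}\mathrm{tr}(T^2\beta)\bigr)\,\rho_\theta(Y)\,\sigma^\beta(v),$$ where $T\bmod\mathfrak p_F=[v]+Y$ with $Y\in\mathfrak g_\beta(\mathbb F)$ and $[v]\in V$ representing $v\in\mathbb V_\beta$. Let $U:G_\beta(O_F/\mathfrak p_F^r)\to GL_{\mathbb C}(L^2(\mathbb W'))$ be a homomorphism with $\sigma^{\beta,\theta}(h^{-1}gh)=U(h)^{-1}\sigma^{\beta,\theta}(g)U(h)$ for $h\in G_\beta(O_F/\mathfrak p_F^r)$, $g\in K_{l-1}$, and $U(h)=1$ for $h\in G_\beta(O_F/\mathfrak p_F^r)\cap K_{l-1}$. Then $\sigma_{\beta,\theta}$ is the representation of $G(\beta)$ on $L^2(\mathbb W')$ given by $\sigma_{\beta,\theta}(hg)=\theta(h)\,U(h)\circ\sigma^{\beta,\theta}(g)$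 for $h\in G_\beta(O_F/\mathfrak p_F^r)$, $g\in K_{l-1}$. **Proposition.** For all such $\theta$ and all choices of the auxiliary data, $$\dim\delta_{\beta,\theta}=\frac{q^{r\,n(n-1)/2}}{1-q^{-f}}\cdot\frac{1}{\bigl(O_F^\times:N_{K/F}(O_K^\times)\bigr)}\cdot\prod_{k=1}^{n}\bigl(1-q^{-k}\bigr).$$ -/

import Mathlib

open ValuativeRel

namespace RegularRep

/-! ### Extensions of rings of integers -/

section Integers

variable (F K : Type*) [Field F] [ValuativeRel F] [Field K] [ValuativeRel K]
  [Algebra F K] [ValuativeExtension F K]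

theorem algebraMap_mem_integer (x : 𝒪[F]) : algebraMap F K x ∈ 𝒪[K] := by
  have h1 : (x : F) ≤ᵥ (1 : F) := by
    rw [Valuation.Compatible.vle_iff_le (v := valuation F), map_one]
    exact x.2
  have h2 := (ValuativeExtension.vle_iff_vle (A := F) (B := K) (x : F) 1).2 h1
  rw [Valuation.Compatible.vle_iff_le (v := valuation K), map_one, map_one] at h2
  exact h2

/-- For an extension `K/F` of valued fields, `O_K` is an `O_F`-algebra. -/
noncomputable instance integerAlgebra : Algebra 𝒪[F] 𝒪[K] :=
  (((algebraMap F K).comp (𝒪[F]).subtype).codRestrict 𝒪[K]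
    (algebraMap_mem_integer F K)).toAlgebra

@[simp]
theorem coe_algebraMap_integer (x : 𝒪[F]) :
    ((algebraMap 𝒪[F] 𝒪[K] x : 𝒪[K]) : K) = algebraMap F K x := rfl

instance isLocalHom_integer : IsLocalHom (algebraMap 𝒪[F] 𝒪[K]) := by
  constructor
  intro a ha
  have hK : valuation K (algebraMap F K a) = 1 :=
    (Valuation.integer.integers (valuation K)).isUnit_iff_valuation_eq_one.1 ha
  refine (Valuation.integer.integers (valuation F)).isUnit_iff_valuation_eq_one.2 ?_
  have h2 : (algebraMap F K 1) ≤ᵥ (algebraMap F K (a : F)) := by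
    rw [Valuation.Compatible.vle_iff_le (v := valuation K), hK, map_one, map_one]
  have h3 := (ValuativeExtension.vle_iff_vle (A := F) (B := K) _ _).1 h2
  rw [Valuation.Compatible.vle_iff_le (v := valuation F), map_one] at h3
  exact le_antisymm a.2 h3

/-- `U_{K/F}`, the group of units of `O_K` of norm one (for `O_K` free of finite rank over `O_F`,
the norm of `O_K` over `O_F` is the restriction of `N_{K/F}`). -/
noncomputable def normOneUnits : Subgroup (𝒪[K])ˣ :=
  (Units.map (Algebra.norm 𝒪[F] : 𝒪[K] →* 𝒪[F])).ker

/-- `N_{K/F}(O_K^×)`, as a subgroup of `O_F^×`. -/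
noncomputable def normUnits : Subgroup (𝒪[F])ˣ :=
  (Units.map (Algebra.norm 𝒪[F] : 𝒪[K] →* 𝒪[F])).range

/-- The ideal `𝔭_F^m O_K` of `O_K`, that is `𝔭_K^{em}` with `e` the ramification index. -/
noncomputable def extIdeal (m : ℕ) : Ideal 𝒪[K] :=
  (𝓂[F] ^ m).map (algebraMap 𝒪[F] 𝒪[K])

end Integers

/-! ### The finite groups `SL_n(O_F/𝔭^r)` and their subgroups -/

section Groups

variable (F : Type*) [Field F] [ValuativeRel F]

/-- `O_F/𝔭^m`. -/
abbrev Quo (m : ℕ) : Type _ := 𝒪[F] ⧸ 𝓂[F] ^ m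

/-- `G(O_F/𝔭^m) = SL_n(O_F/𝔭^m)`. -/
abbrev SLQuo (n m : ℕ) : Type _ := Matrix.SpecialLinearGroup (Fin n) (Quo F m)

/-- Reduction of matrices `M_n(O_F) → M_n(O_F/𝔭^m)`. -/
noncomputable def redMat (n m : ℕ) :
    Matrix (Fin n) (Fin n) 𝒪[F] →+* Matrix (Fin n) (Fin n) (Quo F m) :=
  (Ideal.Quotient.mk (𝓂[F] ^ m)).mapMatrix

/-- Reduction of matrices `M_n(O_F) → M_n(𝔽)`, with `𝔽` the residue field. -/
noncomputable def resMat (n : ℕ) :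
    Matrix (Fin n) (Fin n) 𝒪[F] →+* Matrix (Fin n) (Fin n) 𝓀[F] :=
  (IsLocalRing.residue 𝒪[F]).mapMatrix

variable {F}

/-- The canonical homomorphism `G(O_F/𝔭^r) → G(O_F/𝔭^m)` for `m ≤ r`. -/
noncomputable def redSL (n : ℕ) {m r : ℕ} (h : m ≤ r) : SLQuo F n r →* SLQuo F n m :=
  Matrix.SpecialLinearGroup.map (Ideal.Quotient.factorPow 𝓂[F] h)

/-- `K_m(O_F/𝔭^r)`, the kernel of `G(O_F/𝔭^r) → G(O_F/𝔭^m)`. -/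
noncomputable def congSubgroup (n : ℕ) {m r : ℕ} (h : m ≤ r) : Subgroup (SLQuo F n r) :=
  (redSL n h).ker

/-- For `r ≥ 2`, `l = upper r` is the least integer with `r = l + l'` and `0 < l' ≤ l`. -/
def upper (r : ℕ) : ℕ := (r + 1) / 2

/-- The integer `l'` with `r = l + l'`, where `l = upper r`. -/
def lower (r : ℕ) : ℕ := r / 2

theorem upper_le (r : ℕ) : upper r ≤ r := by unfold upper; omega

theorem lower_le (r : ℕ) : lower r ≤ r := by unfold lower; omega

variable {n : ℕ}

/-- The centralizer `G_β(O_F/𝔭^m)` of `β mod 𝔭^m` in `G(O_F/𝔭^m)`. -/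
noncomputable def centSL (B : Matrix (Fin n) (Fin n) 𝒪[F]) (m : ℕ) :
    Subgroup (SLQuo F n m) where
  carrier := {g | (g : Matrix (Fin n) (Fin n) (Quo F m)) * redMat F n m B = redMat F n m B * g}
  one_mem' := by simp
  mul_mem' := by
    intro a b ha hb
    simp only [Set.mem_ofPred_eq, Matrix.SpecialLinearGroup.coe_mul] at *
    rw [mul_assoc, hb, ← mul_assoc, ha, mul_assoc]
  inv_mem' := by
    intro a ha
    simp only [Set.mem_ofPred_eq] at *
    have h1 : ((a⁻¹ : SLQuo F n m) : Matrix (Fin n) (Fin n) (Quo F m)) * a = 1 := by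
      rw [← Matrix.SpecialLinearGroup.coe_mul, inv_mul_cancel, Matrix.SpecialLinearGroup.coe_one]
    have h2 : (a : Matrix (Fin n) (Fin n) (Quo F m)) * (a⁻¹ : SLQuo F n m) = 1 := by
      rw [← Matrix.SpecialLinearGroup.coe_mul, mul_inv_cancel, Matrix.SpecialLinearGroup.coe_one]
    calc ((a⁻¹ : SLQuo F n m) : Matrix (Fin n) (Fin n) (Quo F m)) * redMat F n m B
        = (a⁻¹ : SLQuo F n m) * (redMat F n m B * a) * (a⁻¹ : SLQuo F n m) := by
          rw [mul_assoc, mul_assoc, h2, mul_one]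
      _ = redMat F n m B * (a⁻¹ : SLQuo F n m) := by
          rw [← ha, ← mul_assoc, h1, one_mul]

/-- `G(O_F/𝔭^r; β)`, the group of the `g ∈ G(O_F/𝔭^r)` with `Ad(g)β ≡ β mod 𝔭^{l'}`, which is the
stabilizer of the character `χ_β` of `K_l(O_F/𝔭^r)`. -/
noncomputable def stabSL (B : Matrix (Fin n) (Fin n) 𝒪[F]) (r : ℕ) : Subgroup (SLQuo F n r) :=
  (centSL B (lower r)).comap (redSL n (lower_le r))

/-- For `g ∈ K_m(O_F/𝔭^r)`, a matrix `T ∈ M_n(O_F)` such that `g = 1 + ϖ^m T mod 𝔭^r`. It exists by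
`exists_coeffMat`; nothing defined from it below depends on the choice of `T`. -/
noncomputable def coeffMat (ϖ : 𝒪[F]) (m : ℕ) {r : ℕ} (g : SLQuo F n r) :
    Matrix (Fin n) (Fin n) 𝒪[F] :=
  Classical.epsilon fun T =>
    (g : Matrix (Fin n) (Fin n) (Quo F r)) = redMat F n r (1 + ϖ ^ m • T)

theorem exists_coeffMat {ϖ : 𝒪[F]} (hϖ : 𝓂[F] = Ideal.span {ϖ}) {m r : ℕ} (h : m ≤ r)
    (g : SLQuo F n r) (hg : g ∈ congSubgroup n h) :
    (g : Matrix (Fin n) (Fin n) (Quo F r)) = redMat F n r (1 + ϖ ^ m • coeffMat ϖ m g) := by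
  refine Classical.epsilon_spec (p := fun T =>
    (g : Matrix (Fin n) (Fin n) (Quo F r)) = redMat F n r (1 + ϖ ^ m • T)) ?_
  have key : ∀ i j, ∃ t : 𝒪[F], g i j =
      Ideal.Quotient.mk (𝓂[F] ^ r) ((1 : Matrix (Fin n) (Fin n) 𝒪[F]) i j + ϖ ^ m * t) := by
    intro i j
    obtain ⟨a, ha⟩ := Ideal.Quotient.mk_surjective (g i j)
    have h1 : redSL n h g = 1 := hg
    have h2 : Ideal.Quotient.mk (𝓂[F] ^ m) a =
        (1 : Matrix (Fin n) (Fin n) (Quo F m)) i j := by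
      have h3 : (redSL n h g : Matrix (Fin n) (Fin n) (Quo F m)) i j =
          (1 : Matrix (Fin n) (Fin n) (Quo F m)) i j := by
        rw [h1, Matrix.SpecialLinearGroup.coe_one]
      rw [← h3]
      change _ = Ideal.Quotient.factorPow 𝓂[F] h (g i j)
      rw [← ha]
      rfl
    have h4 : (1 : Matrix (Fin n) (Fin n) (Quo F m)) i j =
        Ideal.Quotient.mk (𝓂[F] ^ m) ((1 : Matrix (Fin n) (Fin n) 𝒪[F]) i j) := by
      simp only [Matrix.one_apply]
      split_ifs <;> simp
    rw [h4, Ideal.Quotient.eq, hϖ, Ideal.span_singleton_pow, Ideal.mem_span_singleton] at h2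
    obtain ⟨t, ht⟩ := h2
    exact ⟨t, by rw [← ha, ← ht]; congr 1; ring⟩
  choose T hT using key
  exact ⟨Matrix.of T, by ext i j; rw [hT i j]; rfl⟩

end Groups

/-! ### The symplectic space `𝕍_β` and the Schrödinger representation -/

section Symplectic

variable {n : ℕ} {k : Type*} [Field k]

/-- `𝔤(k)`, the trace-zero matrices. -/
abbrev TraceZero (n : ℕ) (k : Type*) [Field k] : Submodule k (Matrix (Fin n) (Fin n) k) :=
  LinearMap.ker (Matrix.traceLinearMap (Fin n) k k)

/-- `𝔤_β(k)`, the centralizer of `β` in `𝔤(k)`. -/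
def centLie (B : Matrix (Fin n) (Fin n) k) : Submodule k (TraceZero n k) where
  carrier := {X | (X : Matrix (Fin n) (Fin n) k) * B = B * X}
  zero_mem' := by simp
  add_mem' := by
    intro X Y hX hY
    simp only [Set.mem_ofPred_eq, Submodule.coe_add] at *
    rw [add_mul, mul_add, hX, hY]
  smul_mem' := by
    intro c X hX
    simp only [Set.mem_ofPred_eq, Submodule.coe_smul] at *
    rw [Matrix.smul_mul, Matrix.mul_smul, hX]

/-- `𝕍_β = 𝔤(k)/𝔤_β(k)`. -/
abbrev VSpace (B : Matrix (Fin n) (Fin n) k) : Type _ := TraceZero n k ⧸ centLie B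

/-- The form `(X, Y) ↦ tr([X, Y] β)` on `𝔤(k)`. -/
def commForm (B : Matrix (Fin n) (Fin n) k) : TraceZero n k →ₗ[k] TraceZero n k →ₗ[k] k :=
  LinearMap.mk₂ k (fun X Y => (((X : Matrix (Fin n) (Fin n) k) * Y - Y * X) * B).trace)
    (by
      intro X X' Y
      simp only [Submodule.coe_add, ← Matrix.trace_add]
      congr 1; noncomm_ring)
    (by
      intro c X Y
      simp only [Submodule.coe_smul, Matrix.smul_mul, Matrix.mul_smul, ← smul_sub,
        Matrix.trace_smul])
    (by
      intro X Y Y'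
      simp only [Submodule.coe_add, ← Matrix.trace_add]
      congr 1; noncomm_ring)
    (by
      intro c X Y
      simp only [Submodule.coe_smul, Matrix.smul_mul, Matrix.mul_smul, ← smul_sub,
        Matrix.trace_smul])

theorem commForm_apply (B : Matrix (Fin n) (Fin n) k) (X Y : TraceZero n k) :
    commForm B X Y = (((X : Matrix (Fin n) (Fin n) k) * Y - Y * X) * B).trace := rfl

theorem centLie_le_ker (B : Matrix (Fin n) (Fin n) k) : centLie B ≤ (commForm B).ker := by
  intro X hX
  have hX' : (X : Matrix (Fin n) (Fin n) k) * B = B * X := hX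
  rw [LinearMap.mem_ker]
  ext Y
  have h1 : ((X : Matrix (Fin n) (Fin n) k) * (Y : Matrix (Fin n) (Fin n) k) * B).trace =
      ((Y : Matrix (Fin n) (Fin n) k) * (X : Matrix (Fin n) (Fin n) k) * B).trace := by
    rw [mul_assoc, Matrix.trace_mul_comm, mul_assoc, mul_assoc, hX']
  rw [commForm_apply, sub_mul, Matrix.trace_sub, h1, sub_self]
  rfl

theorem centLie_le_ker_flip (B : Matrix (Fin n) (Fin n) k) :
    centLie B ≤ (commForm B).flip.ker := by
  intro X hX
  have h := centLie_le_ker B hX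
  rw [LinearMap.mem_ker] at h ⊢
  ext Y
  have h1 : commForm B X Y = 0 := by rw [h]; rfl
  have h2 : commForm B Y X = - commForm B X Y := by
    rw [commForm_apply, commForm_apply, ← Matrix.trace_neg, ← neg_mul, neg_sub]
  rw [LinearMap.flip_apply, h2, h1]
  simp

/-- The symplectic form `D_β` on `𝕍_β` induced by `(X, Y) ↦ tr([X, Y] β)`. -/
noncomputable def sympForm (B : Matrix (Fin n) (Fin n) k) :
    VSpace B →ₗ[k] VSpace B →ₗ[k] k :=
  LinearMap.liftQ₂ (centLie B) (centLie B) (commForm B) (centLie_le_ker B)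
    (centLie_le_ker_flip B)

/-- `𝕍_β = W' ⊕ W` is a polarization: `W'` and `W` are complementary and totally isotropic
with respect to `D_β`. -/
structure IsPolarization (B : Matrix (Fin n) (Fin n) k) (W' W : Submodule k (VSpace B)) :
    Prop where
  isCompl : IsCompl W' W
  isotropic' : ∀ u ∈ W', ∀ v ∈ W', sympForm B u v = 0
  isotropic : ∀ u ∈ W, ∀ v ∈ W, sympForm B u v = 0

/-- The operator `σ^β(u, s)` of the Schrödinger representation of the Heisenberg group
`𝕍_β × ℂ^1` on the space `L²(W')` of complex valued functions on the finite set `W'`: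
`(σ^β(u, s) f)(w) = s · ψ̂(2⁻¹ D_β(u₋, u₊) + D_β(w, u₊)) · f(w + u₋)` for
`u = u₋ + u₊ ∈ W' ⊕ W`, where `ψ̂` is an additive character of `k`. -/
noncomputable def schrodinger (ψhat : k → Circle) (B : Matrix (Fin n) (Fin n) k)
    {W' W : Submodule k (VSpace B)} (hW : IsPolarization B W' W) (u : VSpace B) (s : ℂ) :
    Module.End ℂ (W' → ℂ) :=
  let um : W' := ((Submodule.prodEquivOfIsCompl W' W hW.isCompl).symm u).1
  let up : W := ((Submodule.prodEquivOfIsCompl W' W hW.isCompl).symm u).2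
  { toFun := fun f w =>
      s * (ψhat (2⁻¹ * sympForm B um up + sympForm B w up) : ℂ) * f (w + um)
    map_add' := by intro f g; ext w; simp [mul_add]
    map_smul' := by intro c f; ext w; simp; ring }

/-- A trace-zero matrix, as an element of `𝔤(k)` (and `0` for all other matrices). -/
noncomputable def toTraceZero (M : Matrix (Fin n) (Fin n) k) : TraceZero n k :=
  open scoped Classical in if h : M ∈ TraceZero n k then ⟨M, h⟩ else 0

end Symplectic

/-! ### The representations `δ_{β,θ}` of `SL_n(O_F/𝔭^r)` -/

section Representations

variable {F : Type*} [Field F] [ValuativeRel F] {n : ℕ}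

/-- `χ_β(1 + ϖ^l X mod 𝔭^r) = ψ(ϖ^{-l'} tr(X β))` on `K_l(O_F/𝔭^r)`, where `r = l + l'`. -/
noncomputable def chi (ψ : AddChar F Circle) (ϖ : 𝒪[F]) (B : Matrix (Fin n) (Fin n) 𝒪[F])
    {r : ℕ} (g : SLQuo F n r) : Circle :=
  ψ ((ϖ : F) ^ (-(lower r : ℤ)) * ((coeffMat ϖ (upper r) g * B).trace : 𝒪[F]))

/-- The additive character `x mod 𝔭 ↦ ψ(ϖ⁻¹ x)` of the residue field (independent of the lift `x`
when `ψ` is trivial on `O_F`). -/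
noncomputable def psiHat (ψ : AddChar F Circle) (ϖ : 𝒪[F]) (x : 𝓀[F]) : Circle :=
  ψ ((ϖ : F)⁻¹ *
    (Function.surjInv (IsLocalRing.residue_surjective (R := 𝒪[F])) x : 𝒪[F]))

/-- `1 + ϖ^{l-1} X + 2⁻¹ ϖ^{2l-2} X²` for `r = 2l - 1` (here `l - 1 = l'`, and `2` is a unit of
`O_F` when the residue characteristic is odd). -/
noncomputable def truncExp (ϖ : 𝒪[F]) (r : ℕ) (X : Matrix (Fin n) (Fin n) 𝒪[F]) :
    Matrix (Fin n) (Fin n) 𝒪[F] :=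
  1 + ϖ ^ lower r • X + (Ring.inverse (2 : 𝒪[F]) * ϖ ^ (2 * lower r)) • X ^ 2

/-- `X ∈ 𝔤_β(O_F)` is a lift of `Y ∈ 𝔤_β(𝔽)` and `h ∈ G_β(O_F/𝔭^r)` is the class of
`1 + ϖ^{l-1} X + 2⁻¹ ϖ^{2l-2} X²`. -/
def IsExpLift (ϖ : 𝒪[F]) (B : Matrix (Fin n) (Fin n) 𝒪[F]) {r : ℕ}
    (Y : centLie (resMat F n B)) (z : Matrix (Fin n) (Fin n) 𝒪[F] × centSL B r) : Prop :=
  z.1.trace = 0 ∧ z.1 * B = B * z.1 ∧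
    resMat F n z.1 = ((Y : TraceZero n 𝓀[F]) : Matrix (Fin n) (Fin n) 𝓀[F]) ∧
    ((z.2 : SLQuo F n r) : Matrix (Fin n) (Fin n) (Quo F r)) = redMat F n r (truncExp ϖ r z.1)

/-- For `r = 2l - 1`, the additive character `ρ_θ` of `𝔤_β(𝔽)`:
`ρ_θ(X mod 𝔭) = ψ(-ϖ^{-l} tr(X β)) · θ(1 + ϖ^{l-1} X + 2⁻¹ ϖ^{2l-2} X² mod 𝔭^r)` for
`X ∈ 𝔤_β(O_F)`. -/
noncomputable def rhoTheta (ψ : AddChar F Circle) (ϖ : 𝒪[F])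
    (B : Matrix (Fin n) (Fin n) 𝒪[F]) {r : ℕ} (θ : centSL B r →* Circle)
    (Y : centLie (resMat F n B)) : Circle :=
  open scoped Classical in
  if h : ∃ z : Matrix (Fin n) (Fin n) 𝒪[F] × centSL B r, IsExpLift ϖ B Y z then
    ψ (-((ϖ : F) ^ (-(upper r : ℤ)) * ((h.choose.1 * B).trace : 𝒪[F]))) * θ h.choose.2
  else 1

/-- For `r = 2l - 1`, the operators `σ^{β,θ}(g)` for `g = 1 + ϖ^{l-1} T mod 𝔭^r` in
`K_{l-1}(O_F/𝔭^r)`: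
`σ^{β,θ}(g) = ψ(ϖ^{-l} tr(T β) - 2⁻¹ ϖ⁻¹ tr(T² β)) · ρ_θ(Y) · σ^β(v, 1)`, where
`T mod 𝔭 = [v] + Y` with `Y ∈ 𝔤_β(𝔽)` and `[v] ∈ V` the representative of `v ∈ 𝕍_β` in the fixed
complement `V` of `𝔤_β(𝔽)` in `𝔤(𝔽)`. -/
noncomputable def sigmaCong (ψ : AddChar F Circle) (ϖ : 𝒪[F])
    (B : Matrix (Fin n) (Fin n) 𝒪[F]) {r : ℕ} (θ : centSL B r →* Circle)
    {V : Submodule 𝓀[F] (TraceZero n 𝓀[F])} (hV : IsCompl V (centLie (resMat F n B)))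
    {W' W : Submodule 𝓀[F] (VSpace (resMat F n B))} (hW : IsPolarization (resMat F n B) W' W)
    (g : SLQuo F n r) : Module.End ℂ (W' → ℂ) :=
  let T := coeffMat ϖ (lower r) g
  let vY := (Submodule.prodEquivOfIsCompl V (centLie (resMat F n B)) hV).symm
    (toTraceZero (resMat F n T))
  ((ψ ((ϖ : F) ^ (-(upper r : ℤ)) * ((T * B).trace : 𝒪[F])
      - (2 : F)⁻¹ * (ϖ : F)⁻¹ * ((T ^ 2 * B).trace : 𝒪[F])) : ℂ) *
    (rhoTheta ψ ϖ B θ vY.2 : ℂ)) •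
    schrodinger (psiHat ψ ϖ) (resMat F n B) hW ((centLie (resMat F n B)).mkQ vY.1) 1

/-- For `r` even, `σ` is the character `σ_{β,θ}(h g) = θ(h) χ_β(g)`
(`h ∈ G_β(O_F/𝔭^r)`, `g ∈ K_l(O_F/𝔭^r)`) of `G(O_F/𝔭^r; β) = G_β(O_F/𝔭^r) · K_l(O_F/𝔭^r)`. -/
def IsSigmaEven (ψ : AddChar F Circle) (ϖ : 𝒪[F]) (B : Matrix (Fin n) (Fin n) 𝒪[F]) {r : ℕ}
    (θ : centSL B r →* Circle) (σ : Representation ℂ (stabSL B r) ℂ) : Prop :=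
  ∀ (s : stabSL B r) (h : centSL B r) (g : SLQuo F n r),
    g ∈ congSubgroup n (upper_le r) → (s : SLQuo F n r) = h * g →
      σ s = ((θ h : ℂ) * (chi ψ ϖ B g : ℂ)) • LinearMap.id

/-- For `r = 2l - 1` odd, `U` is a homomorphism `G_β(O_F/𝔭^r) → GL(L²(W'))` with
`σ^{β,θ}(h⁻¹ g h) = U(h)⁻¹ σ^{β,θ}(g) U(h)` for `h ∈ G_β(O_F/𝔭^r)`, `g ∈ K_{l-1}(O_F/𝔭^r)`, and
`U(h) = 1` for `h ∈ G_β(O_F/𝔭^r) ∩ K_{l-1}(O_F/𝔭^r)`. -/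
structure IsIntertwiner (ψ : AddChar F Circle) (ϖ : 𝒪[F])
    (B : Matrix (Fin n) (Fin n) 𝒪[F]) {r : ℕ} (θ : centSL B r →* Circle)
    {V : Submodule 𝓀[F] (TraceZero n 𝓀[F])} (hV : IsCompl V (centLie (resMat F n B)))
    {W' W : Submodule 𝓀[F] (VSpace (resMat F n B))} (hW : IsPolarization (resMat F n B) W' W)
    (U : centSL B r →* ((W' → ℂ) ≃ₗ[ℂ] (W' → ℂ))) : Prop where
  conj : ∀ (h : centSL B r) (g : SLQuo F n r), g ∈ congSubgroup n (lower_le r) →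
    sigmaCong ψ ϖ B θ hV hW ((h : SLQuo F n r)⁻¹ * g * h) =
      ((U h)⁻¹).toLinearMap ∘ₗ sigmaCong ψ ϖ B θ hV hW g ∘ₗ (U h).toLinearMap
  trivial : ∀ h : centSL B r, (h : SLQuo F n r) ∈ congSubgroup n (lower_le r) → U h = 1

/-- For `r = 2l - 1` odd, `σ` is the representation
`σ_{β,θ}(h g) = θ(h) · U(h) ∘ σ^{β,θ}(g)` (`h ∈ G_β(O_F/𝔭^r)`, `g ∈ K_{l-1}(O_F/𝔭^r)`) of
`G(O_F/𝔭^r; β) = G_β(O_F/𝔭^r) · K_{l-1}(O_F/𝔭^r)` on `L²(W')`. -/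
def IsSigmaOdd (ψ : AddChar F Circle) (ϖ : 𝒪[F]) (B : Matrix (Fin n) (Fin n) 𝒪[F]) {r : ℕ}
    (θ : centSL B r →* Circle)
    {V : Submodule 𝓀[F] (TraceZero n 𝓀[F])} (hV : IsCompl V (centLie (resMat F n B)))
    {W' W : Submodule 𝓀[F] (VSpace (resMat F n B))} (hW : IsPolarization (resMat F n B) W' W)
    (U : centSL B r →* ((W' → ℂ) ≃ₗ[ℂ] (W' → ℂ)))
    (σ : Representation ℂ (stabSL B r) (W' → ℂ)) : Prop :=
  ∀ (s : stabSL B r) (h : centSL B r) (g : SLQuo F n r),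
    g ∈ congSubgroup n (lower_le r) → (s : SLQuo F n r) = h * g →
      σ s = (θ h : ℂ) • ((U h).toLinearMap ∘ₗ sigmaCong ψ ϖ B θ hV hW g)

/-- `δ` is (isomorphic to) the representation `δ_{β,θ} = Ind σ_{β,θ}` of `G(O_F/𝔭^r)`, induced
from `G(O_F/𝔭^r; β)`, for a character `θ` of `G_β(O_F/𝔭^r)`. In the odd case it is formed with
some choice of the auxiliary data: the complement `V`, the polarization `𝕍_β = W' ⊕ W` and the
homomorphism `U`. -/
def IsDelta (ψ : AddChar F Circle) (ϖ : 𝒪[F]) (B : Matrix (Fin n) (Fin n) 𝒪[F]) {r : ℕ}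
    (θ : centSL B r →* Circle) {M : Type*} [AddCommGroup M] [Module ℂ M]
    (δ : Representation ℂ (SLQuo F n r) M) : Prop :=
  (Even r ∧ ∃ σ : Representation ℂ (stabSL B r) ℂ, IsSigmaEven ψ ϖ B θ σ ∧
    Nonempty (δ.Equiv (Representation.ind (stabSL B r).subtype σ))) ∨
  (Odd r ∧
    ∃ (V : Submodule 𝓀[F] (TraceZero n 𝓀[F])) (hV : IsCompl V (centLie (resMat F n B)))
      (W' W : Submodule 𝓀[F] (VSpace (resMat F n B))) (hW : IsPolarization (resMat F n B) W' W)
      (U : centSL B r →* ((W' → ℂ) ≃ₗ[ℂ] (W' → ℂ)))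
      (σ : Representation ℂ (stabSL B r) (W' → ℂ)),
      IsIntertwiner ψ ϖ B θ hV hW U ∧ IsSigmaOdd ψ ϖ B θ hV hW U σ ∧
        Nonempty (δ.Equiv (Representation.ind (stabSL B r).subtype σ)))

end Representations

section Extension

variable {F K : Type*} [Field F] [ValuativeRel F] [Field K] [ValuativeRel K]
  [Algebra F K] [ValuativeExtension F K] {n : ℕ}

/-- The two conditions on a character `θ` of `U_{K/F}`: it factors through
`U_{K/F} → (O_K/𝔭_K^{er})^×`, and `θ(ε) = ψ(ϖ^{-l'} T_{K/F}(x β))` whenever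
`ε ≡ 1 + ϖ^l x mod 𝔭_K^{er}` with `x ∈ O_K` and `T_{K/F}(x) ≡ 0 mod 𝔭_F^{l'}`.
(The first condition makes `θ` continuous.) -/
structure IsAdmissible (ψ : AddChar F Circle) (ϖ : 𝒪[F]) (β : 𝒪[K]) (r : ℕ)
    (θ : normOneUnits F K →* Circle) : Prop where
  factors : ∀ ε : normOneUnits F K,
    (((ε : (𝒪[K])ˣ) : 𝒪[K]) - 1) ∈ extIdeal F K r → θ ε = 1
  restrict : ∀ (ε : normOneUnits F K) (x : 𝒪[K]),
    Algebra.trace 𝒪[F] 𝒪[K] x ∈ 𝓂[F] ^ lower r →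
    (((ε : (𝒪[K])ˣ) : 𝒪[K]) - (1 + algebraMap 𝒪[F] 𝒪[K] ϖ ^ upper r * x)) ∈ extIdeal F K r →
      θ ε = ψ ((ϖ : F) ^ (-(lower r : ℤ)) * (Algebra.trace 𝒪[F] 𝒪[K] (x * β) : 𝒪[F]))

/-- `δ` is (isomorphic to) `δ_{β,θ}` for `β ∈ O_K` and a character `θ` of `U_{K/F}`. Here `O_K` is
embedded in `M_n(O_F)` by the regular representation with respect to the `O_F`-basis `b`, and `θ`
is viewed as a character `θ'` of `G_β(O_F/𝔭^r)` through the canonical map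
`U_{K/F} = G_β(O_F) → G_β(O_F/𝔭^r)`. -/
def IsDeltaExt (ψ : AddChar F Circle) (ϖ : 𝒪[F]) (b : Module.Basis (Fin n) 𝒪[F] 𝒪[K])
    (β : 𝒪[K]) {r : ℕ} (θ : normOneUnits F K →* Circle)
    {M : Type*} [AddCommGroup M] [Module ℂ M] (δ : Representation ℂ (SLQuo F n r) M) : Prop :=
  ∃ θ' : centSL (Algebra.leftMulMatrix b β) r →* Circle,
    (∀ (ε : normOneUnits F K) (h : centSL (Algebra.leftMulMatrix b β) r),
      ((h : SLQuo F n r) : Matrix (Fin n) (Fin n) (Quo F r)) =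
        redMat F n r (Algebra.leftMulMatrix b ((ε : (𝒪[K])ˣ) : 𝒪[K])) → θ' h = θ ε) ∧
    IsDelta ψ ϖ (Algebra.leftMulMatrix b β) θ' δ

end Extension

end RegularRep

/-! Induction multiplies dimension by the index (`finrank_indV`), so the dimension is [SL_n(O_F/𝔭^r)
: G(β)] · dim σ. As G(β) is the full preimage of the centralizer of β modulo 𝔭^{l'}, its index can
be computed over R = O_F/𝔭^{l'} (`index_stabSL`).

The order of SL_n(R) follows from that of GL_n over the residue field (`card_SL_of_residue`). For
the centralizer, O_K = O_F[β] makes 1 a cyclic vector, so the matrices commuting with β form a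
quotient ring of O_K with |R|^n elements. Those of determinant one are the kernel of the norm on its
units. The image of this norm has index (O_F^× : N(O_K^×)) in R^×, because a principal unit is an
n-th power when p ∤ n, hence a norm (`ker_units_map_le_normUnits`). This is `card_centralizer_SL`;
dividing the two orders gives `index_centSL`, with leading power q^{l'n(n-1)}.

For r = 2l' the representation σ is one-dimensional and the exponent is already r·n(n-1)/2. For r =
2l'+1 it acts on the functions on a Lagrangian W' of a nondegenerate space of dimension n(n-1)
(`polarization_two_mul_finrank`), and the extra factor q^{n(n-1)/2} restores the same exponent. -/

/-! ### The dimension of an induced representation -/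

section Induced

open Representation

variable {k G A : Type*} [Field k] [Group G] {H : Subgroup G} [AddCommGroup A] [Module k A]

/-- A coinduced module is the space of functions on a right transversal. -/
noncomputable def coindVEquivFun (σ : Representation k H A) {T : Set G}
    (hT : Subgroup.IsComplement (H : Set G) T) :
    coindV H.subtype σ ≃ₗ[k] (T → A) where
  toFun f t := f.1 t
  map_add' _ _ := rfl
  map_smul' _ _ := rfl
  -- Writing g = ht with h in H and t in T, equivariance forces the value at g to be σ(h) f(t).
  invFun f := ⟨fun g => σ (hT.equiv g).1 (f (hT.equiv g).2), by
    intro s g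
    have h := hT.equiv_mul_left s g
    simp only [Subgroup.coe_subtype]
    rw [h]
    exact congrFun (congrArg DFunLike.coe (map_mul σ s (hT.equiv g).1)) _⟩
  left_inv f := by
    ext g
    have h := f.2 (hT.equiv g).1 (hT.equiv g).2
    have h' := hT.equiv_fst_mul_equiv_snd g
    simp only
    rw [← h]
    exact congrArg f.1 h'
  right_inv f := by
    ext t
    have h1 : (hT.equiv t).2 = t := by
      have := hT.equiv_snd_eq_self_of_mem_of_one_mem (g := (t : G)) H.one_mem t.2
      simpa using this
    have h2 : (hT.equiv t).1 = ⟨1, H.one_mem⟩ :=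
      hT.equiv_fst_eq_one_of_mem_of_one_mem H.one_mem t.2
    simp only [h1, h2]
    exact congrFun (congrArg DFunLike.coe (map_one σ)) _

/-- For a finite group induction and coinduction agree, and a coinduced function is determined
freely by its values on a transversal, which has as many elements as the index. -/
theorem finrank_indV [Finite G] [FiniteDimensional k A] (σ : Representation k H A) :
    Module.finrank k (IndV H.subtype σ) = H.index * Module.finrank k A := by
  classical
  obtain ⟨T, hT, -⟩ := H.exists_isComplement_right 1
  have : Fintype T := Fintype.ofFinite _
  let e : IndV H.subtype σ ≃ₗ[k] coindV H.subtype σ :=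
    .ofLinearMap (Rep.indToCoind (Rep.of σ)) (Rep.coindToInd (Rep.of σ))
      (Rep.coindToInd_indToCoind _) (Rep.indToCoind_coindToInd _)
  rw [(e.trans (coindVEquivFun σ hT)).finrank_eq, Module.finrank_pi_fintype, Finset.sum_const,
    smul_eq_mul, Finset.card_univ, ← Nat.card_eq_fintype_card, hT.card_right]

end Induced

/-! ### Orders of unit groups and of special linear groups -/

section Units

/-- For a surjective local homomorphism of finite rings, the proportion of units is the same in
both. -/
theorem card_units_mul_card_of_surjective {A B : Type*} [Ring A] [Ring B] [Finite A]
    (g : A →+* B) [IsLocalHom g] (hg : Function.Surjective g) :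
    Nat.card Aˣ * Nat.card B = Nat.card A * Nat.card Bˣ := by
  have : Finite B := Finite.of_surjective g hg
  have hs : Function.Surjective (Units.map (g : A →* B)) :=
    IsLocalRing.surjective_units_map_of_local_ringHom g hg ‹_›
  -- The map u ↦ u - 1 matches the multiplicative kernel with the additive one; locality of `g` is
  -- what makes every 1 + a with g(a) = 0 a unit.
  let e : (Units.map (g : A →* B)).ker ≃ (g : A →+ B).ker :=
    { toFun := fun u => ⟨(u : Aˣ) - 1, by
        have h : g ((u : Aˣ) : A) = 1 := congrArg Units.val u.2
        simp [AddMonoidHom.mem_ker, h]⟩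
      invFun := fun a => by
        have h : g (a.1 + 1) = 1 := by
          have h0 : g a.1 = 0 := a.2
          simp [h0]
        have hu : IsUnit (a.1 + 1) := isUnit_of_map_unit g _ (h ▸ isUnit_one)
        exact ⟨hu.unit, Units.ext h⟩
      left_inv := fun u => by ext; simp
      right_inv := fun a => by ext; simp }
  have h1 := (Units.map (g : A →* B)).ker.card_mul_index
  have h2 := (g : A →+ B).ker.card_mul_index
  rw [Subgroup.index_ker, Nat.card_congr e, MonoidHom.range_eq_top.2 hs, Subgroup.card_top] at h1
  rw [AddSubgroup.index_ker, AddMonoidHom.range_eq_top.2 hg, AddSubgroup.card_top] at h2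
  rw [← h1, ← h2]
  ring

/-- Invertibility is detected by the determinant. This allows the unit count above to be applied to
matrix rings, whose units are GL_n. -/
instance isLocalHom_mapMatrix {R k : Type*} [CommRing R] [CommRing k] (g : R →+* k)
    [IsLocalHom g] (n : ℕ) :
    IsLocalHom (g.mapMatrix : Matrix (Fin n) (Fin n) R →+* Matrix (Fin n) (Fin n) k) where
  map_nonunit M hM := by
    rw [Matrix.isUnit_iff_isUnit_det] at hM ⊢
    rw [← RingHom.map_det] at hM
    exact isUnit_of_map_unit g _ hM

theorem mapMatrix_surjective {R k : Type*} [CommRing R] [CommRing k] {g : R →+* k}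
    (hg : Function.Surjective g) (n : ℕ) :
    Function.Surjective
      (g.mapMatrix : Matrix (Fin n) (Fin n) R →+* Matrix (Fin n) (Fin n) k) := fun M => by
  choose s hs using hg
  exact ⟨M.map s, by ext i j; simp [hs]⟩

/-- The determinant maps GL_n onto the units, as diag(u, 1, …, 1) shows, with kernel SL_n. -/
theorem card_SL_mul_card_units {R : Type*} [CommRing R] {n : ℕ} (hn : n ≠ 0) :
    Nat.card (Matrix.SpecialLinearGroup (Fin n) R) * Nat.card Rˣ = Nat.card (GL (Fin n) R) := by
  have : NeZero n := ⟨hn⟩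
  have hs : Function.Surjective (Matrix.GeneralLinearGroup.det (n := Fin n) (R := R)) := fun u => by
    have hd : (Matrix.diagonal (Function.update 1 (0 : Fin n) (u : R))).det = u := by
      rw [Matrix.det_diagonal, Finset.prod_update_of_mem (Finset.mem_univ _)]
      simp
    have hu : IsUnit (Matrix.diagonal (Function.update 1 (0 : Fin n) (u : R))) := by
      rw [Matrix.isUnit_iff_isUnit_det, hd]; exact u.isUnit
    exact ⟨hu.unit, Units.ext hd⟩
  let e : Matrix.SpecialLinearGroup (Fin n) R ≃
      (Matrix.GeneralLinearGroup.det (n := Fin n) (R := R)).ker :=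
    { toFun := fun g => ⟨Matrix.SpecialLinearGroup.toGL g, by
        ext; simp⟩
      invFun := fun g => ⟨g.1.1, congrArg Units.val g.2⟩
      left_inv := fun g => by ext; simp
      right_inv := fun g => by ext; rfl }
  have h := (Matrix.GeneralLinearGroup.det (n := Fin n) (R := R)).ker.card_mul_index
  rwa [Subgroup.index_ker, MonoidHom.range_eq_top.2 hs, Subgroup.card_top, ← Nat.card_congr e] at h

/-- The order of `SL_n` of a finite local ring with residue field `k`. -/
theorem card_SL_of_residue {R k : Type*} [CommRing R] [Field k] [Finite R] (g : R →+* k)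
    [IsLocalHom g] (hg : Function.Surjective g) {n : ℕ} (hn : n ≠ 0) :
    (Nat.card (Matrix.SpecialLinearGroup (Fin n) R) : ℝ) * Nat.card Rˣ =
      (Nat.card R : ℝ) ^ (n * n) * ∏ i ∈ Finset.Icc 1 n, (1 - ((Nat.card k : ℝ) ^ i)⁻¹) := by
  have : Finite k := Finite.of_surjective g hg
  have := Fintype.ofFinite k
  have h1 := card_units_mul_card_of_surjective
    (g.mapMatrix : Matrix (Fin n) (Fin n) R →+* Matrix (Fin n) (Fin n) k)
    (mapMatrix_surjective hg n)
  have h2 : Nat.card (Matrix (Fin n) (Fin n) k) = Nat.card k ^ (n * n) := by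
    simp [Matrix, ← pow_mul]
  have h2' : Nat.card (Matrix (Fin n) (Fin n) R) = Nat.card R ^ (n * n) := by
    simp [Matrix, Nat.card_fun, ← pow_mul]
  rw [h2, h2'] at h1
  have h3 : (Nat.card (GL (Fin n) k) : ℝ) =
      (Nat.card k : ℝ) ^ (n * n) * ∏ i ∈ Finset.Icc 1 n, (1 - ((Nat.card k : ℝ) ^ i)⁻¹) := by
    have hq : (Fintype.card k : ℝ) ≠ 0 := by exact_mod_cast Fintype.card_ne_zero
    have hq1 : 1 ≤ Fintype.card k := Fintype.card_pos
    -- Reversing the product over i turns the factor q^n - q^i into q^n - q^{n-1-i} = q^n (1 -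
    -- q^{-(i+1)}).
    rw [Matrix.card_GL_field, Nat.card_eq_fintype_card, Nat.cast_prod,
      Fin.prod_univ_eq_prod_range (fun i => ((Fintype.card k ^ n - Fintype.card k ^ i : ℕ) : ℝ)) n,
      pow_mul, ← Finset.prod_range_reflect]
    have h4 : Finset.Icc 1 n = (Finset.range n).image (· + 1) := by
      ext i
      simp only [Finset.mem_Icc, Finset.mem_image, Finset.mem_range]
      exact ⟨fun h => ⟨i - 1, by omega, by omega⟩, by rintro ⟨j, hj, rfl⟩; omega⟩
    rw [h4, Finset.prod_image (by intro a _ c _ h; simpa using h)]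
    have h5 : ((Fintype.card k : ℝ) ^ n) ^ n = ∏ _i ∈ Finset.range n, (Fintype.card k : ℝ) ^ n := by
      simp
    rw [h5, ← Finset.prod_mul_distrib]
    refine Finset.prod_congr rfl fun i hi => ?_
    have hi' := Finset.mem_range.1 hi
    rw [Nat.cast_sub (Nat.pow_le_pow_right hq1 (by omega)), Nat.cast_pow, Nat.cast_pow, mul_sub,
      mul_one]
    congr 1
    rw [← div_eq_mul_inv, eq_div_iff (pow_ne_zero _ hq), ← pow_add]
    congr 1
    omega
  have hq : (Nat.card k : ℝ) ^ (n * n) ≠ 0 := by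
    have := (Nat.card_pos (α := k)).ne'
    positivity
  rw [← Nat.cast_mul, card_SL_mul_card_units hn, ← mul_left_inj' hq]
  have h1' : (Nat.card (GL (Fin n) R) : ℝ) * (Nat.card k : ℝ) ^ (n * n) =
      (Nat.card R : ℝ) ^ (n * n) * Nat.card (GL (Fin n) k) := by exact_mod_cast h1
  rw [h1', h3]
  ring

/-- An arbitrary entrywise lift has a determinant that maps to 1, hence is a unit by locality.
Dividing row 0 by it gives determinant one without changing the image. -/
theorem specialLinearGroup_map_surjective {R S : Type*} [CommRing R] [CommRing S] (g : R →+* S)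
    [IsLocalHom g] (hg : Function.Surjective g) {n : ℕ} (hn : n ≠ 0) :
    Function.Surjective (Matrix.SpecialLinearGroup.map (n := Fin n) g) := fun M => by
  have : NeZero n := ⟨hn⟩
  obtain ⟨N, hN⟩ := mapMatrix_surjective hg n M.1
  have hd : g N.det = 1 := by rw [RingHom.map_det, hN, M.2]
  obtain ⟨u, hu⟩ := isUnit_of_map_unit g N.det (hd ▸ isUnit_one)
  have hgu : g ((u⁻¹ : Rˣ) : R) = 1 := by
    have h : g (u * (u⁻¹ : Rˣ)) = 1 := by rw [Units.mul_inv, map_one]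
    rwa [map_mul, hu, hd, one_mul] at h
  refine ⟨⟨N.updateRow 0 (((u⁻¹ : Rˣ) : R) • fun j => N 0 j), ?_⟩, ?_⟩
  · rw [Matrix.det_updateRow_smul, Matrix.updateRow_eq_self, ← hu, Units.inv_mul]
  · ext i j
    have hij : g (N i j) = M.1 i j := by rw [← hN]; rfl
    change g (N.updateRow 0 _ i j) = _
    rw [Matrix.updateRow_apply]
    split_ifs with h
    · subst h; simp [hgu, hij]
    · exact hij

end Units

/-! ### The centralizer of a monogenic regular representation -/

section Centralizer

open Matrix

variable {O A R : Type*} [CommRing O] [CommRing A] [Algebra O A] [CommRing R] {n : ℕ}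
  (b : Module.Basis (Fin n) O A) (f : O →+* R)

/-- The regular representation with respect to `b`, with entries mapped to `R` by `f`. -/
noncomputable def regRep : A →+* Matrix (Fin n) (Fin n) R :=
  f.mapMatrix.comp (Algebra.leftMulMatrix b).toRingHom

theorem regRep_apply (x : A) : regRep b f x = f.mapMatrix (Algebra.leftMulMatrix b x) := rfl

theorem regRep_mulVec (x y : A) :
    regRep b f x *ᵥ (fun i => f (b.repr y i)) = fun i => f (b.repr (x * y) i) := by
  ext i
  rw [← Algebra.leftMulMatrix_mulVec_repr b x y]
  simp [regRep_apply, mulVec, dotProduct, map_sum]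

theorem det_regRep (x : A) : (regRep b f x).det = f (Algebra.norm O x) := by
  rw [regRep_apply, Algebra.norm_eq_matrix_det b, RingHom.map_det]

theorem regRep_comm (x y : A) : regRep b f x * regRep b f y = regRep b f y * regRep b f x := by
  rw [← map_mul, mul_comm, map_mul]

theorem matrix_ext_of_mulVec_repr {M N : Matrix (Fin n) (Fin n) R}
    (h : ∀ y : A, M *ᵥ (fun i => f (b.repr y i)) = N *ᵥ fun i => f (b.repr y i)) : M = N := by
  ext i j
  have hj : (fun i => f (b.repr (b j) i)) = Pi.single j 1 := by
    ext i
    rw [Module.Basis.repr_self, Finsupp.single_apply, Pi.single_apply]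
    split_ifs <;> simp_all
  have := congrFun (h (b j)) i
  rw [hj] at this
  simpa using this

variable {β : A}

/-- The elements whose regular matrix commutes with `M` form a subalgebra, and it contains the
generator. -/
theorem commute_regRep_of_adjoin (hβ : Algebra.adjoin O {β} = ⊤) {M : Matrix (Fin n) (Fin n) R}
    (hM : M * regRep b f β = regRep b f β * M) (x : A) :
    M * regRep b f x = regRep b f x * M := by
  have hx : x ∈ Algebra.adjoin O {β} := hβ ▸ Algebra.mem_top
  induction hx using Algebra.adjoin_induction with
  | mem x hx => rw [Set.mem_singleton_iff.1 hx]; exact hM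
  | algebraMap r =>
    have : regRep b f (algebraMap O A r) = Matrix.scalar (Fin n) (f r) := by
      ext i j
      simp [regRep_apply, AlgHom.commutes, Matrix.algebraMap_matrix_apply, diagonal_apply,
        apply_ite f]
    rw [this]
    exact (Matrix.scalar_commute (f r) (fun s => Commute.all _ s) M).symm
  | add x y _ _ hx hy => rw [map_add, mul_add, add_mul, hx, hy]
  | mul x y _ _ hx hy => rw [map_mul, ← mul_assoc, hx, mul_assoc, hy, mul_assoc]

/-- The matrices that commute with `B`, as a submodule. -/
def commMat (B : Matrix (Fin n) (Fin n) R) : Submodule R (Matrix (Fin n) (Fin n) R) where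
  carrier := {M | M * B = B * M}
  zero_mem' := by simp
  add_mem' := by
    intro X Y hX hY
    simp only [Set.mem_ofPred_eq] at *
    rw [add_mul, mul_add, hX, hY]
  smul_mem' := by
    intro c X hX
    simp only [Set.mem_ofPred_eq] at *
    rw [Matrix.smul_mul, Matrix.mul_smul, hX]

/-- Evaluation at the coordinate vector of `1`. -/
noncomputable def evalOne (B : Matrix (Fin n) (Fin n) R) : commMat B →ₗ[R] (Fin n → R) :=
  (Matrix.mulVecBilin R R).flip (fun i => f (b.repr 1 i)) ∘ₗ (commMat B).subtype

theorem evalOne_apply (B : Matrix (Fin n) (Fin n) R) (M : commMat B) :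
    evalOne b f B M = M.1 *ᵥ (fun i => f (b.repr 1 i)) := rfl

/-- The vector of 1 is cyclic: M commutes with multiplication by every y, so its value at y = y · 1
is y applied to its value at 1. -/
theorem evalOne_injective (hβ : Algebra.adjoin O {β} = ⊤) :
    Function.Injective (evalOne b f (regRep b f β)) := by
  rw [injective_iff_map_eq_zero]
  intro M hM
  rw [evalOne_apply] at hM
  refine Subtype.ext (matrix_ext_of_mulVec_repr b f fun y => ?_)
  have h := commute_regRep_of_adjoin b f hβ M.2 y
  rw [← mul_one y, ← regRep_mulVec, mulVec_mulVec, h, ← mulVec_mulVec, hM]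
  simp

theorem exists_regRep_evalOne (hf : Function.Surjective f) (w : Fin n → R) :
    ∃ x : A, regRep b f x *ᵥ (fun i => f (b.repr 1 i)) = w := by
  choose g hg using hf
  refine ⟨b.equivFun.symm (g ∘ w), ?_⟩
  rw [regRep_mulVec, mul_one]
  ext i
  rw [← Module.Basis.equivFun_apply, LinearEquiv.apply_symm_apply, Function.comp_apply, hg]

/-- The centralizer of a generator of `A` is free of rank `n`. -/
noncomputable def commMatEquiv (hβ : Algebra.adjoin O {β} = ⊤) (hf : Function.Surjective f) :
    commMat (regRep b f β) ≃ₗ[R] (Fin n → R) :=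
  LinearEquiv.ofBijective (evalOne b f (regRep b f β)) ⟨evalOne_injective b f hβ, fun w => by
    obtain ⟨x, hx⟩ := exists_regRep_evalOne b f hf w
    exact ⟨⟨regRep b f x, regRep_comm b f x β⟩, hx⟩⟩

/-- Some multiplication by x agrees with `M` at the vector of 1, and agreement there suffices for
matrices in the centralizer. -/
theorem mem_range_regRep (hβ : Algebra.adjoin O {β} = ⊤) (hf : Function.Surjective f)
    {M : Matrix (Fin n) (Fin n) R} (hM : M * regRep b f β = regRep b f β * M) :
    ∃ x, regRep b f x = M := by
  obtain ⟨x, hx⟩ := exists_regRep_evalOne b f hf (M *ᵥ fun i => f (b.repr 1 i))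
  have h : (⟨regRep b f x, regRep_comm b f x β⟩ : commMat (regRep b f β)) = ⟨M, hM⟩ :=
    evalOne_injective b f hβ hx
  exact ⟨x, congrArg Subtype.val h⟩

end Centralizer

/-! ### The dimension of a Lagrangian subspace of `𝕍_β` -/

section Lagrangian

open Module RegularRep

variable {k : Type*} [Field k] {n : ℕ} {B : Matrix (Fin n) (Fin n) k}

theorem finrank_traceZero (hn : n ≠ 0) : finrank k (TraceZero n k) + 1 = n * n := by
  have : NeZero n := ⟨hn⟩
  have h := (Matrix.traceLinearMap (Fin n) k k).finrank_range_add_finrank_ker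
  have hs : Function.Surjective (Matrix.traceLinearMap (Fin n) k k) := fun c =>
    ⟨Matrix.single 0 0 c, by simp⟩
  rw [LinearMap.range_eq_top.2 hs, finrank_top, finrank_self, finrank_matrix] at h
  simp only [Fintype.card_fin, finrank_self, mul_one] at h
  rw [add_comm]
  exact h

/-- The scalars lie in the full centralizer and have nonzero traces since n is invertible, so
imposing trace zero costs exactly one dimension. -/
theorem finrank_centLie (hn : (n : k) ≠ 0) (hB : finrank k (commMat B) = n) :
    finrank k (centLie B) + 1 = n := by
  let t : commMat B →ₗ[k] k := Matrix.traceLinearMap (Fin n) k k ∘ₗ (commMat B).subtype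
  have hs : Function.Surjective t := fun c =>
    ⟨⟨(c / n) • 1, by simp [commMat]⟩, by simp [t, Matrix.trace_one, hn]⟩
  have h := t.finrank_range_add_finrank_ker
  rw [LinearMap.range_eq_top.2 hs, finrank_top, finrank_self, hB] at h
  let e : centLie B ≃ₗ[k] LinearMap.ker t :=
    { toFun := fun X => ⟨⟨X.1.1, X.2⟩, X.1.2⟩
      map_add' := fun _ _ => rfl
      map_smul' := fun _ _ => rfl
      invFun := fun X => ⟨⟨X.1.1, X.2⟩, X.1.2⟩
      left_inv := fun _ => rfl
      right_inv := fun _ => rfl }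
  rw [e.finrank_eq]
  omega

theorem finrank_vSpace (hn : (n : k) ≠ 0) (hB : finrank k (commMat B) = n) :
    finrank k (VSpace B) = n * (n - 1) := by
  have h0 : n ≠ 0 := by rintro rfl; simp at hn
  have h1 := (centLie B).finrank_quotient_add_finrank
  have h2 := finrank_centLie hn hB
  have h3 := finrank_traceZero (k := k) h0
  have h4 : n * n = n * (n - 1) + n := by
    obtain ⟨m, rfl⟩ := Nat.exists_eq_succ_of_ne_zero h0
    simp [Nat.mul_succ]
  simp only [VSpace]
  omega

/-- Cyclicity of the trace gives tr([X,Y]B) = -tr(ZY) with Z = XB - BX, so Z is orthogonal to all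
trace-zero matrices. As Z itself has trace zero it is orthogonal to scalars too, and these together
span everything because n is invertible. Hence Z = 0. -/
theorem mem_centLie_of_commForm (hn : (n : k) ≠ 0) (X : TraceZero n k)
    (h : ∀ Y, commForm B X Y = 0) : X ∈ centLie B := by
  set Z : Matrix (Fin n) (Fin n) k := X.1 * B - B * X.1 with hZ
  have htr : Z.trace = 0 := by rw [hZ, Matrix.trace_sub, Matrix.trace_mul_comm, sub_self]
  have h1 : ∀ Y : Matrix (Fin n) (Fin n) k, Y.trace = 0 → (Z * Y).trace = 0 := by
    intro Y hY
    have h0 : ((X.1 * Y - Y * X.1) * B).trace = 0 := h ⟨Y, hY⟩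
    rw [sub_mul, Matrix.trace_sub] at h0
    rw [hZ, sub_mul, Matrix.trace_sub, mul_assoc B, Matrix.trace_mul_comm B, mul_assoc X.1 B Y,
      ← Matrix.trace_mul_comm (B * Y), mul_assoc B, Matrix.trace_mul_comm B]
    linear_combination -h0
  have h2 : ∀ Y : Matrix (Fin n) (Fin n) k, (Z * Y).trace = 0 := by
    intro Y
    have h3 := h1 (Y - (Y.trace / n) • 1) (by simp [Matrix.trace_one, hn])
    simpa [mul_sub, htr] using h3
  have h3 : Z = 0 := Matrix.ext_iff_trace_mul_right.2 (by simpa using h2)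
  exact sub_eq_zero.1 h3

theorem sympForm_mk (X Y : TraceZero n k) :
    sympForm B ((centLie B).mkQ X) ((centLie B).mkQ Y) = commForm B X Y := rfl

theorem sympForm_neg (u v : VSpace B) : sympForm B v u = -sympForm B u v := by
  obtain ⟨X, rfl⟩ := (centLie B).mkQ_surjective u
  obtain ⟨Y, rfl⟩ := (centLie B).mkQ_surjective v
  rw [sympForm_mk, sympForm_mk, commForm_apply, commForm_apply, ← Matrix.trace_neg, ← neg_mul,
    neg_sub]

theorem sympForm_nondegenerate (hn : (n : k) ≠ 0) (u : VSpace B)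
    (h : ∀ v, sympForm B u v = 0) : u = 0 := by
  obtain ⟨X, rfl⟩ := (centLie B).mkQ_surjective u
  rw [Submodule.mkQ_apply, Submodule.Quotient.mk_eq_zero]
  exact mem_centLie_of_commForm hn X fun Y => h ((centLie B).mkQ Y)

theorem polarization_symm {W' W : Submodule k (VSpace B)} (hW : IsPolarization B W' W) :
    IsPolarization B W W' :=
  ⟨hW.isCompl.symm, hW.isotropic, hW.isotropic'⟩

/-- The form embeds W' into the dual of W: a vector of W' orthogonal to W is orthogonal to W' as
well by isotropy, hence to the whole space. Exchanging the roles of W' and W gives equality. -/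
theorem polarization_finrank_le (hn : (n : k) ≠ 0) {W' W : Submodule k (VSpace B)}
    (hW : IsPolarization B W' W) : finrank k W' ≤ finrank k W := by
  let d : W' →ₗ[k] Dual k W := (sympForm B).domRestrict₁₂ W' W
  have hd : Function.Injective d := by
    rw [injective_iff_map_eq_zero]
    intro u hu
    refine Subtype.ext (sympForm_nondegenerate hn _ fun v => ?_)
    have hv : v ∈ W' ⊔ W := hW.isCompl.sup_eq_top ▸ Submodule.mem_top
    obtain ⟨x, hx, y, hy, rfl⟩ := Submodule.mem_sup.1 hv
    have h1 : sympForm B u y = 0 := LinearMap.congr_fun hu ⟨y, hy⟩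
    rw [map_add, hW.isotropic' u u.2 x hx, h1, add_zero]
  simpa [Subspace.dual_finrank_eq] using LinearMap.finrank_le_finrank_of_injective hd

theorem polarization_two_mul_finrank (hn : (n : k) ≠ 0) (hB : finrank k (commMat B) = n)
    {W' W : Submodule k (VSpace B)} (hW : IsPolarization B W' W) :
    2 * finrank k W' = n * (n - 1) := by
  have h1 := Submodule.finrank_add_eq_of_isCompl hW.isCompl
  have h2 := polarization_finrank_le hn hW
  have h3 := polarization_finrank_le hn (polarization_symm hW)
  rw [finrank_vSpace hn hB] at h1
  omega

end Lagrangian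

/-! ### The order of the centralizer in `SL_n` -/

section CardCentralizer

open IsLocalRing

/-- A nonzero quotient of a local ring has the same residue field. -/
theorem exists_residue_of_surjective {A S : Type*} [CommRing A] [IsLocalRing A] [CommRing S]
    [Nontrivial S] (f : A →+* S) (hf : Function.Surjective f) :
    ∃ g : S →+* ResidueField A, IsLocalHom g ∧ Function.Surjective g := by
  have hl : IsLocalHom f := hf.isLocalHom
  have hk : RingHom.ker f ≤ RingHom.ker (residue A) := by
    rw [ker_residue]
    exact le_maximalIdeal (RingHom.ker_ne_top f)
  have hg := RingHom.liftOfSurjective_comp_apply f hf ⟨residue A, hk⟩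
  refine ⟨RingHom.liftOfSurjective f hf ⟨residue A, hk⟩, ⟨fun s hs => ?_⟩, fun y => ?_⟩
  · obtain ⟨a, rfl⟩ := hf s
    rw [hg] at hs
    exact (isUnit_of_map_unit (residue A) a hs).map f
  · obtain ⟨a, rfl⟩ := residue_surjective y
    exact ⟨f a, hg a⟩

variable {O A R : Type*} [CommRing O] [CommRing A] [Algebra O A] [CommRing R] {n : ℕ}
  (b : Module.Basis (Fin n) O A) (f : O →+* R) {β : A}

/-- The quotient is isomorphic to the image of the regular representation, which is the whole
centralizer of β, free of rank n over R. -/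
theorem card_quotient_ker_regRep (hβ : Algebra.adjoin O {β} = ⊤) (hf : Function.Surjective f) :
    Nat.card (A ⧸ RingHom.ker (regRep b f)) = Nat.card R ^ n := by
  have e : (regRep b f).range ≃ commMat (regRep b f β) :=
    Equiv.subtypeEquivRight fun M => ⟨by rintro ⟨x, rfl⟩; exact regRep_comm b f x β,
      fun hM => mem_range_regRep b f hβ hf hM⟩
  rw [Nat.card_congr (RingHom.quotientKerEquivRange (regRep b f)).toEquiv, Nat.card_congr e,
    Nat.card_congr (commMatEquiv b f hβ hf).toEquiv, Nat.card_fun]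
  simp

/-- The norm from the units of the quotient of `A` that acts faithfully in the regular
representation over `R`. -/
noncomputable def quotientNorm : (A ⧸ RingHom.ker (regRep b f))ˣ →* Rˣ :=
  Units.map (Matrix.detMonoidHom.comp (RingHom.kerLift (regRep b f)).toMonoidHom)

theorem card_ker_quotientNorm (hβ : Algebra.adjoin O {β} = ⊤) (hf : Function.Surjective f) :
    Nat.card (quotientNorm b f).ker = Nat.card {g : Matrix.SpecialLinearGroup (Fin n) R //
      (g : Matrix (Fin n) (Fin n) R) * regRep b f β = regRep b f β * g} := by
  let j : (quotientNorm b f).ker → {g : Matrix.SpecialLinearGroup (Fin n) R //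
      (g : Matrix (Fin n) (Fin n) R) * regRep b f β = regRep b f β * g} := fun u =>
    ⟨⟨RingHom.kerLift (regRep b f) (u : (A ⧸ RingHom.ker (regRep b f))ˣ),
      congrArg Units.val u.2⟩, by
        obtain ⟨x, hx⟩ := Ideal.Quotient.mk_surjective
          (((u : (A ⧸ RingHom.ker (regRep b f))ˣ)) : A ⧸ RingHom.ker (regRep b f))
        simp only [← hx, RingHom.kerLift_mk]
        exact regRep_comm b f x β⟩
  refine Nat.card_eq_of_bijective j ⟨fun u v h => ?_, fun g => ?_⟩
  · have h' := congrArg (fun z => (z.1 : Matrix (Fin n) (Fin n) R)) h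
    exact Subtype.ext (Units.ext (RingHom.kerLift_injective _ h'))
  · obtain ⟨x, hx⟩ := mem_range_regRep b f hβ hf g.2
    have hg : (g.1 : Matrix (Fin n) (Fin n) R) * (g.1⁻¹ : Matrix.SpecialLinearGroup (Fin n) R) = 1 := by
      rw [← Matrix.SpecialLinearGroup.coe_mul, mul_inv_cancel, Matrix.SpecialLinearGroup.coe_one]
    have hg' : ((g.1⁻¹ : Matrix.SpecialLinearGroup (Fin n) R) : Matrix (Fin n) (Fin n) R) * g.1 = 1 := by
      rw [← Matrix.SpecialLinearGroup.coe_mul, inv_mul_cancel, Matrix.SpecialLinearGroup.coe_one]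
    -- The inverse matrix also commutes with β, so it too comes from an element of A; thus the class
    -- of `x` is a unit of the quotient.
    have hgi : ((g.1⁻¹ : Matrix.SpecialLinearGroup (Fin n) R) : Matrix (Fin n) (Fin n) R) *
        regRep b f β = regRep b f β * (g.1⁻¹ : Matrix.SpecialLinearGroup (Fin n) R) :=
      Commute.units_inv_left (u := ⟨g.1.1, g.1⁻¹.1, hg, hg'⟩) g.2
    obtain ⟨y, hy⟩ := mem_range_regRep b f hβ hf hgi
    have hxy : Ideal.Quotient.mk (RingHom.ker (regRep b f)) x * Ideal.Quotient.mk _ y = 1 := by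
      apply RingHom.kerLift_injective
      rw [map_mul, RingHom.kerLift_mk, RingHom.kerLift_mk, map_one, hx, hy, hg]
    refine ⟨⟨Units.mkOfMulEqOne _ _ hxy, ?_⟩, ?_⟩
    · refine Units.ext ?_
      change (RingHom.kerLift (regRep b f) (Ideal.Quotient.mk _ x)).det = 1
      rw [RingHom.kerLift_mk, hx, g.1.2]
    · refine Subtype.ext (Subtype.ext ?_)
      change RingHom.kerLift (regRep b f) (Ideal.Quotient.mk _ x) = _
      rw [RingHom.kerLift_mk, hx]

/-- The group in question is the kernel of the norm on the units of a finite local quotient of A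
with the same residue field. Three counts are combined: the proportion of units in that quotient,
kernel times image of the norm, and image times its index in R^×. Hypothesis `hN` identifies that
last index with the index of the norms in O^×. -/
theorem card_centralizer_SL [IsLocalRing O] [IsLocalRing A] [Finite R] [Nontrivial R] (hn : n ≠ 0)
    (hβ : Algebra.adjoin O {β} = ⊤) (hf : Function.Surjective f)
    (hN : (Units.map (f : O →* R)).ker ≤ (Units.map (Algebra.norm O : A →* O)).range) :
    Nat.card {g : Matrix.SpecialLinearGroup (Fin n) R //
      (g : Matrix (Fin n) (Fin n) R) * regRep b f β = regRep b f β * g} * Nat.card Rˣ *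
        Nat.card (ResidueField A) =
      Nat.card R ^ n * Nat.card (ResidueField A)ˣ *
        (Units.map (Algebra.norm O : A →* O)).range.index := by
  have : NeZero n := ⟨hn⟩
  have hl : IsLocalHom f := hf.isLocalHom
  have hcard := card_quotient_ker_regRep b f hβ hf
  have : Finite (A ⧸ RingHom.ker (regRep b f)) := Nat.finite_of_card_ne_zero (by
    rw [hcard]; exact pow_ne_zero _ Nat.card_pos.ne')
  have : Nontrivial (A ⧸ RingHom.ker (regRep b f)) :=
    Ideal.Quotient.nontrivial_iff.2 (RingHom.ker_ne_top _)
  have hmk := Ideal.Quotient.mk_surjective (I := RingHom.ker (regRep b f))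
  have hmkl : IsLocalHom (Ideal.Quotient.mk (RingHom.ker (regRep b f))) := hmk.isLocalHom
  obtain ⟨g, hg, hgs⟩ := exists_residue_of_surjective _ hmk
  have h1 := card_units_mul_card_of_surjective g hgs
  -- Units of the quotient lift to units of A, and reduction carries the norm to the determinant, so
  -- the image is the reduction of the norm group.
  have hrange : (quotientNorm b f).range =
      ((Units.map (Algebra.norm O : A →* O)).range).map (Units.map (f : O →* R)) := by
    have hs := surjective_units_map_of_local_ringHom _ hmk hmkl
    have hc : (quotientNorm b f).comp
          (Units.map (Ideal.Quotient.mk (RingHom.ker (regRep b f))).toMonoidHom) =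
        (Units.map (f : O →* R)).comp (Units.map (Algebra.norm O : A →* O)) := by
      ext u
      exact det_regRep b f u
    rw [MonoidHom.map_range, ← hc, ← MonoidHom.map_range, MonoidHom.range_eq_top.2 hs,
      ← MonoidHom.range_eq_map]
  have hu := surjective_units_map_of_local_ringHom f hf hl
  have h2 := (quotientNorm b f).range.card_mul_index
  have hidx : (quotientNorm b f).range.index =
      (Units.map (Algebra.norm O : A →* O)).range.index := by
    rw [hrange]
    exact Subgroup.index_map_eq _ hu hN
  rw [hidx] at h2
  have h3 := (quotientNorm b f).ker.card_mul_index
  rw [Subgroup.index_ker, card_ker_quotientNorm b f hβ hf] at h3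
  rw [← hcard, ← h1, ← h2, ← h3]
  ring

end CardCentralizer

/-! ### Local fields -/

section LocalField

open RegularRep IsLocalRing

variable {F : Type*} [Field F] [ValuativeRel F]

theorem nontrivial_quo {m : ℕ} (hm : m ≠ 0) : Nontrivial (Quo F m) :=
  Ideal.Quotient.nontrivial_iff.2
    (ne_top_of_le_ne_top Ideal.IsPrime.ne_top' (Ideal.pow_le_self hm))

variable [TopologicalSpace F] [IsNonarchimedeanLocalField F]

theorem natCard_quo (m : ℕ) : Nat.card (Quo F m) = Nat.card 𝓀[F] ^ m := by
  have h := cardQuot_pow_of_prime (IsDiscreteValuationRing.not_a_field 𝒪[F]) (i := m)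
  rwa [Submodule.cardQuot_apply, Submodule.cardQuot_apply] at h

instance finite_quo (m : ℕ) : Finite (Quo F m) :=
  Nat.finite_of_card_ne_zero (by rw [natCard_quo]; exact pow_ne_zero _ Nat.card_pos.ne')

/-- A principal unit is an `n`-th power when `n` is prime to the residue characteristic. -/
theorem exists_pow_eq_of_sub_one_mem {n : ℕ} (hn : (n : 𝓀[F]) ≠ 0) {u : 𝒪[F]}
    (hu : u - 1 ∈ 𝓂[F]) : ∃ a : 𝒪[F], a ^ n = u := by
  let := IsTopologicalAddGroup.rightUniformSpace F
  have := isUniformAddGroup_of_addCommGroup (G := F)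
  have hH : HenselianRing 𝒪[F] 𝓂[F] := inferInstance
  have hn0 : n ≠ 0 := by rintro rfl; simp at hn
  have h1 : IsUnit ((n : ℕ) : 𝒪[F]) := by
    refine isUnit_of_map_unit (residue 𝒪[F]) _ ?_
    rw [map_natCast]
    exact hn.isUnit
  -- Hensel's lemma for X^n - u at the approximate root 1, where the derivative n is a unit.
  obtain ⟨a, ha, -⟩ := hH.is_henselian (Polynomial.X ^ n - Polynomial.C u)
    (Polynomial.monic_X_pow_sub_C u hn0) 1
    (by
      rw [← neg_mem_iff]
      simpa using hu)
    (by
      refine IsUnit.map _ ?_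
      simpa [Polynomial.derivative_X_pow] using h1)
  exact ⟨a, by simpa [Polynomial.IsRoot, sub_eq_zero] using ha⟩

theorem redSL_surjective {n : ℕ} (hn : n ≠ 0) {m r : ℕ} (hm : m ≠ 0) (h : m ≤ r) :
    Function.Surjective (redSL (F := F) n h) := by
  have : Nontrivial (Quo F m) := nontrivial_quo hm
  have : Nontrivial (Quo F r) := nontrivial_quo (by omega)
  have hmk := Ideal.Quotient.mk_surjective (I := 𝓂[F] ^ r)
  have : IsLocalRing (Quo F r) := IsLocalRing.of_surjective' _ hmk
  have hs : Function.Surjective (Ideal.Quotient.factorPow 𝓂[F] h) := Ideal.Quotient.factor_surjective _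
  have : IsLocalHom (Ideal.Quotient.factorPow 𝓂[F] h) := hs.isLocalHom
  exact specialLinearGroup_map_surjective _ hs hn

/-- The stabilizer is a full preimage under a surjection, so its index can be read at level l'; the
factorization G_β · K_{l'} is not needed for this. -/
theorem index_stabSL {n : ℕ} (hn : n ≠ 0) (B : Matrix (Fin n) (Fin n) 𝒪[F]) {r : ℕ} (hr : 1 < r) :
    (stabSL B r).index = (centSL B (lower r)).index :=
  Subgroup.index_comap_of_surjective _
    (redSL_surjective hn (by unfold lower; omega) (lower_le r))

variable {K : Type*} [Field K] [ValuativeRel K] [Algebra F K] [ValuativeExtension F K] {n : ℕ}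

/-- A unit congruent to 1 modulo 𝔭 is a^n for some a in O_F, and a^n is the norm of a. -/
theorem ker_units_map_le_normUnits (hn : (n : 𝓀[F]) ≠ 0) (b : Module.Basis (Fin n) 𝒪[F] 𝒪[K])
    {m : ℕ} (hm : m ≠ 0) :
    (Units.map (Ideal.Quotient.mk (𝓂[F] ^ m) : 𝒪[F] →* Quo F m)).ker ≤ normUnits F K := by
  intro u hu
  have hn0 : n ≠ 0 := by rintro rfl; simp at hn
  have h1 : Ideal.Quotient.mk (𝓂[F] ^ m) (u : 𝒪[F]) = Ideal.Quotient.mk (𝓂[F] ^ m) 1 := by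
    rw [map_one]
    exact congrArg Units.val hu
  obtain ⟨a, ha⟩ := exists_pow_eq_of_sub_one_mem hn
    (Ideal.pow_le_self hm (Ideal.Quotient.eq.1 h1))
  have hau : IsUnit a := (isUnit_pow_iff hn0).1 (ha ▸ u.isUnit)
  refine ⟨Units.map (algebraMap 𝒪[F] 𝒪[K]).toMonoidHom hau.unit, Units.ext ?_⟩
  change Algebra.norm 𝒪[F] (algebraMap 𝒪[F] 𝒪[K] a) = u
  rw [Algebra.norm_algebraMap_of_basis b, Fintype.card_fin, ha]

theorem finrank_commMat_resMat (b : Module.Basis (Fin n) 𝒪[F] 𝒪[K]) {β : 𝒪[K]}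
    (hβ : Algebra.adjoin 𝒪[F] {β} = ⊤) :
    Module.finrank 𝓀[F] (commMat (resMat F n (Algebra.leftMulMatrix b β))) = n :=
  (commMatEquiv b (residue 𝒪[F]) hβ residue_surjective).finrank_eq.trans (by simp)

/-- The index already appears in the finite group (O_F/𝔭)^×. Finiteness is needed in order to divide
by it, since an infinite index has value 0. -/
theorem normUnits_index_ne_zero (hn : (n : 𝓀[F]) ≠ 0) (b : Module.Basis (Fin n) 𝒪[F] 𝒪[K]) :
    (normUnits F K).index ≠ 0 := by
  have hs : Function.Surjective (Ideal.Quotient.mk (𝓂[F] ^ 1)) := Ideal.Quotient.mk_surjective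
  have := nontrivial_quo (F := F) one_ne_zero
  have hu := surjective_units_map_of_local_ringHom _ hs hs.isLocalHom
  have h : ((normUnits F K).map (Units.map
      (Ideal.Quotient.mk (𝓂[F] ^ 1) : 𝒪[F] →* Quo F 1))).index = (normUnits F K).index :=
    Subgroup.index_map_eq _ hu (ker_units_map_le_normUnits hn b one_ne_zero)
  rw [← h]
  exact Subgroup.FiniteIndex.index_ne_zero

variable [TopologicalSpace K] [IsNonarchimedeanLocalField K]

/-- The order of `G_β(O_F/𝔭^m)`, up to the order of `(O_F/𝔭^m)^×`. -/
theorem card_centSL_mul (hn : (n : 𝓀[F]) ≠ 0) (b : Module.Basis (Fin n) 𝒪[F] 𝒪[K])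
    {β : 𝒪[K]} (hβ : Algebra.adjoin 𝒪[F] {β} = ⊤) {m : ℕ} (hm : m ≠ 0) :
    Nat.card (centSL (Algebra.leftMulMatrix b β) m) * Nat.card (Quo F m)ˣ * Nat.card 𝓀[K] =
      Nat.card (Quo F m) ^ n * Nat.card 𝓀[K]ˣ * (normUnits F K).index := by
  have := nontrivial_quo (F := F) hm
  have hn0 : n ≠ 0 := by rintro rfl; simp at hn
  exact card_centralizer_SL b (Ideal.Quotient.mk (𝓂[F] ^ m)) hn0 hβ Ideal.Quotient.mk_surjective
    (ker_units_map_le_normUnits hn b hm)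

theorem card_SLQuo (hn : n ≠ 0) {m : ℕ} (hm : m ≠ 0) :
    (Nat.card (SLQuo F n m) : ℝ) * Nat.card (Quo F m)ˣ =
      (Nat.card (Quo F m) : ℝ) ^ (n * n) *
        ∏ k ∈ Finset.Icc 1 n, (1 - ((Nat.card 𝓀[F] : ℝ) ^ k)⁻¹) := by
  have := nontrivial_quo (F := F) hm
  obtain ⟨g, hg, hgs⟩ := exists_residue_of_surjective (Ideal.Quotient.mk (𝓂[F] ^ m))
    Ideal.Quotient.mk_surjective
  exact card_SL_of_residue g hgs hn

theorem natCard_residueField :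
    Nat.card 𝓀[K] = Nat.card 𝓀[F] ^ Module.finrank 𝓀[F] 𝓀[K] := by
  have : Module.Finite 𝓀[F] 𝓀[K] := Module.Finite.of_finite
  exact Module.natCard_eq_pow_finrank

theorem index_centSL (hn : (n : 𝓀[F]) ≠ 0) (b : Module.Basis (Fin n) 𝒪[F] 𝒪[K])
    {β : 𝒪[K]} (hβ : Algebra.adjoin 𝒪[F] {β} = ⊤) {m : ℕ} (hm : m ≠ 0) :
    ((centSL (Algebra.leftMulMatrix b β) m).index : ℝ) =
      (Nat.card 𝓀[F] : ℝ) ^ (m * (n * (n - 1))) /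
          (1 - ((Nat.card 𝓀[F] : ℝ) ^ Module.finrank 𝓀[F] 𝓀[K])⁻¹) *
        (1 / ((normUnits F K).index : ℝ)) *
        ∏ k ∈ Finset.Icc 1 n, (1 - ((Nat.card 𝓀[F] : ℝ) ^ k)⁻¹) := by
  have hn0 : n ≠ 0 := by rintro rfl; simp at hn
  set C := centSL (Algebra.leftMulMatrix b β) m
  have h1 : (Nat.card C : ℝ) * C.index = Nat.card (SLQuo F n m) := by
    exact_mod_cast C.card_mul_index
  have h2 : (Nat.card C : ℝ) * Nat.card (Quo F m)ˣ * Nat.card 𝓀[K] =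
      (Nat.card (Quo F m) : ℝ) ^ n * Nat.card 𝓀[K]ˣ * (normUnits F K).index := by
    exact_mod_cast card_centSL_mul hn b hβ hm
  have h3 := card_SLQuo (F := F) hn0 hm
  have h4 : (Nat.card 𝓀[K] : ℝ) = Nat.card 𝓀[K]ˣ + 1 := by
    exact_mod_cast Nat.card_eq_card_units_add_one 𝓀[K]
  have hC : (Nat.card C : ℝ) ≠ 0 := by exact_mod_cast Nat.card_pos.ne'
  have hI : ((normUnits F K).index : ℝ) ≠ 0 := by exact_mod_cast normUnits_index_ne_zero hn b
  have hR : (Nat.card (Quo F m) : ℝ) ≠ 0 := by exact_mod_cast Nat.card_pos.ne'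
  have hU : (Nat.card (Quo F m)ˣ : ℝ) ≠ 0 := by exact_mod_cast Nat.card_pos.ne'
  have hk : (Nat.card 𝓀[K] : ℝ) ≠ 0 := by exact_mod_cast Nat.card_pos.ne'
  have hku : (Nat.card 𝓀[K]ˣ : ℝ) ≠ 0 := by exact_mod_cast Nat.card_pos.ne'
  have hq : (Nat.card 𝓀[K] : ℝ) = (Nat.card 𝓀[F] : ℝ) ^ Module.finrank 𝓀[F] 𝓀[K] := by
    exact_mod_cast natCard_residueField (F := F) (K := K)
  -- The powers of |R| = q^m in the orders of SL_n and of the centralizer are n² and n; their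
  -- quotient is q^{mn(n-1)}.
  have hpow : (Nat.card 𝓀[F] : ℝ) ^ (m * (n * (n - 1))) * (Nat.card (Quo F m) : ℝ) ^ n =
      (Nat.card (Quo F m) : ℝ) ^ (n * n) := by
    rw [natCard_quo, Nat.cast_pow, pow_mul, ← pow_add]
    congr 1
    obtain ⟨d, rfl⟩ := Nat.exists_eq_succ_of_ne_zero hn0
    simp only [Nat.succ_eq_add_one, Nat.add_sub_cancel]
    ring
  rw [← hq]
  -- The factor 1 - q^{-f} is the proportion of units in the residue field of K.
  have h5 : 1 - (Nat.card 𝓀[K] : ℝ)⁻¹ = Nat.card 𝓀[K]ˣ / Nat.card 𝓀[K] := by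
    rw [eq_div_iff hk, sub_mul, inv_mul_cancel₀ hk, h4]
    ring
  rw [h5]
  set P := ∏ k ∈ Finset.Icc 1 n, (1 - ((Nat.card 𝓀[F] : ℝ) ^ k)⁻¹)
  rw [← h1, ← hpow] at h3
  have hRn := pow_ne_zero n hR
  generalize (Nat.card (Quo F m) : ℝ) ^ n = Rn at *
  generalize (Nat.card 𝓀[F] : ℝ) ^ (m * (n * (n - 1))) = Q at *
  field_simp
  have h6 : (C.index : ℝ) * Rn * (Nat.card 𝓀[K]ˣ * (normUnits F K).index) =
      Rn * (Q * Nat.card 𝓀[K] * P) := by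
    -- The order of R^× occurs in both counts and cancels here.
    linear_combination (-(C.index : ℝ)) * h2 + (Nat.card 𝓀[K] : ℝ) * h3
  refine mul_left_cancel₀ hRn ?_
  linear_combination h6

end LocalField

theorem proposition2p4
    (p : ℕ) (hp2 : p ≠ 2)
    (F : Type*) [Field F] [ValuativeRel F] [TopologicalSpace F] [IsNonarchimedeanLocalField F]
    [CharZero F] [CharP 𝓀[F] p]
    (K : Type*) [Field K] [ValuativeRel K] [TopologicalSpace K] [IsNonarchimedeanLocalField K]
    [Algebra F K] [ValuativeExtension F K]
    (n : ℕ) (hn : 1 < n) (hnK : Module.finrank F K = n) (hpn : p.Coprime n)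
    (ϖ : 𝒪[F]) (hϖ : Irreducible ϖ)
    (ψ : AddChar F Circle) (hψc : Continuous ψ)
    (hψ : {x : F | ∀ y : 𝒪[F], ψ (x * y) = 1} = (𝒪[F] : Set F))
    (b : Module.Basis (Fin n) 𝒪[F] 𝒪[K])
    (β : 𝒪[K]) (hβ : Algebra.adjoin 𝒪[F] {β} = ⊤) (hβ0 : Algebra.trace 𝒪[F] 𝒪[K] β = 0)
    (r : ℕ) (hr : 1 < r)
    (θ : RegularRep.normOneUnits F K →* Circle) (hθ : RegularRep.IsAdmissible ψ ϖ β r θ)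
    (M : Type*) [AddCommGroup M] [Module ℂ M]
    (δ : Representation ℂ (RegularRep.SLQuo F n r) M)
    (hδ : RegularRep.IsDeltaExt ψ ϖ b β θ δ) :
    (Module.finrank ℂ M : ℝ) =
      (Nat.card 𝓀[F] : ℝ) ^ (r * (n * (n - 1) / 2)) /
          (1 - ((Nat.card 𝓀[F] : ℝ) ^ Module.finrank 𝓀[F] 𝓀[K])⁻¹) *
        (1 / ((RegularRep.normUnits F K).index : ℝ)) *
        ∏ k ∈ Finset.Icc 1 n, (1 - ((Nat.card 𝓀[F] : ℝ) ^ k)⁻¹) := by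
  have hn0 : n ≠ 0 := by omega
  have hnk : (n : 𝓀[F]) ≠ 0 := fun h => CharP.char_ne_one 𝓀[F] p
    (Nat.dvd_one.1 (hpn ▸ Nat.dvd_gcd dvd_rfl ((CharP.cast_eq_zero_iff 𝓀[F] p n).1 h)))
  have hl : RegularRep.lower r ≠ 0 := by unfold RegularRep.lower; omega
  -- The division by 2 in the exponent is exact, as n(n-1) is even.
  have heven : n * (n - 1) = 2 * (n * (n - 1) / 2) :=
    (Nat.mul_div_cancel' (Nat.even_mul_pred_self n).two_dvd).symm
  have hidx := index_centSL hnk b hβ hl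
  rw [← index_stabSL hn0 _ hr, heven] at hidx
  obtain ⟨θ', -, ⟨hre, σ, -, ⟨e⟩⟩ | ⟨hro, V, hV, W', W, hW, U, σ, -, -, ⟨e⟩⟩⟩ := hδ
  · rw [e.toLinearEquiv.finrank_eq, finrank_indV, Module.finrank_self, mul_one, hidx]
    obtain ⟨t, rfl⟩ := hre
    -- Here l' = t, so l'·n(n-1) is the required exponent.
    have h : RegularRep.lower (t + t) * (2 * (n * (n - 1) / 2)) = (t + t) * (n * (n - 1) / 2) := by
      rw [← mul_assoc]
      congr 1
      unfold RegularRep.lower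
      omega
    rw [h]
  · have hfin : Finite (RegularRep.VSpace (RegularRep.resMat F n (Algebra.leftMulMatrix b β))) :=
      Module.finite_of_finite 𝓀[F]
    have : Fintype W' := Fintype.ofFinite _
    have hd := polarization_two_mul_finrank hnk (finrank_commMat_resMat b hβ) hW
    have hd' : Module.finrank 𝓀[F] W' = n * (n - 1) / 2 := by omega
    have hW' : Module.finrank ℂ (W' → ℂ) = Nat.card 𝓀[F] ^ (n * (n - 1) / 2) := by
      rw [Module.finrank_fintype_fun_eq_card, ← Nat.card_eq_fintype_card,
        Module.natCard_eq_pow_finrank (K := 𝓀[F]), hd']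
    rw [e.toLinearEquiv.finrank_eq, finrank_indV, hW', Nat.cast_mul, hidx, Nat.cast_pow]
    obtain ⟨t, rfl⟩ := hro
    -- Here l' = t: the index contributes 2t halves of n(n-1) and the functions on W' the remaining
    -- one.
    have h : (2 * t + 1) * (n * (n - 1) / 2) =
        RegularRep.lower (2 * t + 1) * (2 * (n * (n - 1) / 2)) + n * (n - 1) / 2 := by
      have : RegularRep.lower (2 * t + 1) = t := by unfold RegularRep.lower; omega
      rw [this]
      ring
    rw [h, pow_add]
    ring
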